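/- Let $(X,d)$ be a compact metric space, $f:X\to X$ a continuous map and $\mu$ a Borel probability measure on $X$ with $\mu(f^{-1}(A))=\mu(A)$ for all Borel sets $A$. For a finite Borel partition $\mathcal P$ of $X$ let $H_\mu(\mathcal P)=-\sum_{P\in\mathcal P}\mu(P)\log\mu(P)$ (with $0\log 0=0$). A sequence $\mathcal P_\infty=(\mathcal P_n)_{n\ge0}$ of finite Borel partitions $\mathcal P_n=\{P_{n,1},\dots,P_{n,k_n}\}$ of $X$ is called admissible if $(k_n)_{n\geq 0}$ is bounded and for every $\varepsilon>0$ there are $\delta>0$ and compact sets $K_{n,i}\subset P_{n,i}$ such that, for all $n\ge0$, $\mu(P_{n,i}\setminus K_{n,i})\le\varepsilon$ for $1\le i\le k_n$, and $d(x,y)\ge\delta$ whenever $x\in K_{n,i}$, $y\in K_{n,j}$ and $1\le i<j\le k_n$. The metric entropy of $(X,f,\mu)$, viewed as a nonautonomous system with $X_n=X$, $f_n=f$, $\mu_n=\mu$ for all $n$, is $$h(f_\infty,\mu_\infty)=\sup_{\mathcal P_\infty\text{ admissible}}\ \limsup_{n\to\infty}\frac1n H_\mu\Big(\bigvee_{i=0}^{n-1}f^{-i}\mathcal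 P_i\Big).$$ Then for every finite Borel partition $\mathcal P$ of $X$ the limit $h_\mu(f,\mathcal P)=\lim_{n\to\infty}\frac1n H_\mu\big(\bigvee_{i=0}^{n-1}f^{-i}\mathcal P\big)$ exists, and $$h(f_\infty,\mu_\infty)=h_\mu(f):=\sup_{\mathcal P}h_\mu(f,\mathcal P),$$ where the supremum is over all finite Borel partitions $\mathcal P$ of $X$ and $h_\mu(f)\in[0,\infty]$ is the Kolmogorov–Sinai entropy of $f$ with respect to $\mu$. -/

import Mathlib

open MeasureTheory Filter Topology

noncomputable section

namespace NonautEntropy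

universe u

/-- A finite measurable partition `{P_1, …, P_k}` of `X` (finite Borel partition, if the σ-algebra
is the Borel one). Cells may be empty; empty cells do not contribute to the entropy. -/
structure FinMeasPartition (X : Type u) [MeasurableSpace X] where
  card : ℕ
  cell : Fin card → Set X
  measurableSet_cell : ∀ i, MeasurableSet (cell i)
  disjoint_cell : ∀ i j, i ≠ j → Disjoint (cell i) (cell j)
  iUnion_cell : ⋃ i, cell i = Set.univ

/-- `H_μ(A) = - ∑ i, μ(A i) log μ(A i)` (with `0 log 0 = 0`), the entropy of a finite partition
given as an indexed family of cells. -/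
def partitionEntropy {X : Type u} [MeasurableSpace X] {ι : Type*} [Fintype ι]
    (μ : Measure X) (A : ι → Set X) : ℝ :=
  - ∑ i, μ.real (A i) * Real.log (μ.real (A i))

section Nonautonomous

variable {X : ℕ → Type u}

/-- The time evolution `f_0^n = f_{n-1} ∘ ⋯ ∘ f_0 : X_0 → X_n` of a nonautonomous system. -/
def orbitMap (f : ∀ n, X n → X (n + 1)) : ∀ n, X 0 → X n
  | 0 => id
  | n + 1 => f n ∘ orbitMap f n

/-- The cells of the join `⋁_{i=0}^{n-1} f_0^{-i} P_i`, a partition of `X_0`; a cell is indexed by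
the choice of one cell of `P_i` for each `i < n`. -/
def joinCells [∀ n, MeasurableSpace (X n)] (f : ∀ n, X n → X (n + 1))
    (P : ∀ n, FinMeasPartition (X n)) (n : ℕ) (s : ∀ i : Fin n, Fin (P i).card) : Set (X 0) :=
  ⋂ i : Fin n, orbitMap f i ⁻¹' (P i).cell (s i)

/-- The metric entropy `h(f_∞, μ_∞; P_∞) = limsup_n (1/n) H_{μ_0}(⋁_{i=0}^{n-1} f_0^{-i} P_i)`
with respect to a sequence of finite partitions; it only involves the initial measure. -/
def metricEntropyOn [∀ n, MeasurableSpace (X n)] (f : ∀ n, X n → X (n + 1))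
    (μ : ∀ n, Measure (X n)) (P : ∀ n, FinMeasPartition (X n)) : EReal :=
  limsup (fun n : ℕ => (((1 / (n : ℝ)) * partitionEntropy (μ 0) (joinCells f P n) : ℝ) : EReal))
    atTop

/-- Admissible sequences of partitions: the numbers of cells are bounded and, for each `ε > 0`, the
cells can be approximated from inside, up to measure `ε`, by compact sets `K_{n,i}` whose mutual
distances (for fixed `n`) are bounded below by some `δ > 0` that does not depend on `n`. -/
def IsAdmissible [∀ n, MetricSpace (X n)] [∀ n, MeasurableSpace (X n)]
    (μ : ∀ n, Measure (X n)) (P : ∀ n, FinMeasPartition (X n)) : Prop :=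
  (∃ m : ℕ, ∀ n, (P n).card ≤ m) ∧
  ∀ ε : ℝ, 0 < ε → ∃ δ : ℝ, 0 < δ ∧ ∃ K : ∀ n, Fin (P n).card → Set (X n),
    ∀ n,
      (∀ i, IsCompact (K n i) ∧ K n i ⊆ (P n).cell i ∧
        μ n ((P n).cell i \ K n i) ≤ ENNReal.ofReal ε) ∧
      ∀ i j, i < j → ∀ x ∈ K n i, ∀ y ∈ K n j, δ ≤ dist x y

/-- The metric entropy `h(f_∞, μ_∞)`: the supremum of `h(f_∞, μ_∞; P_∞)` over all admissible
sequences `P_∞`. -/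
def metricEntropy [∀ n, MetricSpace (X n)] [∀ n, MeasurableSpace (X n)]
    (f : ∀ n, X n → X (n + 1)) (μ : ∀ n, Measure (X n)) : EReal :=
  ⨆ (P : ∀ n, FinMeasPartition (X n)) (_ : IsAdmissible μ P), metricEntropyOn f μ P

end Nonautonomous

section KolmogorovSinai

variable {X : Type u} [MeasurableSpace X]

/-- The averages `(1/n) H_μ(⋁_{i=0}^{n-1} T^{-i} P)` for a single map `T` and a single finite
measurable partition `P`. -/
def ksAverage (T : X → X) (μ : Measure X) (P : FinMeasPartition X) (n : ℕ) : ℝ :=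
  (1 / (n : ℝ)) * partitionEntropy μ
    (fun s : Fin n → Fin P.card => ⋂ i : Fin n, T^[i] ⁻¹' P.cell (s i))

/-- The entropy `h_μ(T, P)` of `T` with respect to `P`: the limit of the averages `ksAverage`,
written as an upper limit so that it makes sense without knowing convergence. -/
def ksEntropyOn (T : X → X) (μ : Measure X) (P : FinMeasPartition X) : EReal :=
  limsup (fun n : ℕ => (ksAverage T μ P n : EReal)) atTop

/-- The Kolmogorov–Sinai entropy `h_μ(T)`: the supremum of `h_μ(T, P)` over all finite measurable
partitions. -/
def ksEntropy (T : X → X) (μ : Measure X) : EReal :=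
  ⨆ P : FinMeasPartition X, ksEntropyOn T μ P

end KolmogorovSinai

end NonautEntropy

end

namespace NonautEntropy

/-! The constant sequence of a partition `P` is admissible (inner regularity gives compact subsets,
and finitely many disjoint compact sets have a positive mutual distance), so the metric entropy is
at least the Kolmogorov–Sinai entropy. Conversely, let `P n` be admissible with data ε, δ, `K`. A
single finite partition `Q` with cells of diameter below δ predicts every `P n`: a cell of `Q` meets
`K n i` for at most one `i`, so errors have mass at most ε per cell of `P n`. Since the number of
cells is bounded, H(P n | Q) ≤ η uniformly in n (`lawEntropy_prodMk_le_of_approx`). Strong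
subadditivity and invariance of μ add this up to an error nη for the joins
(`lawEntropy_itinerary_prodMk_le`), that is, η after division by n. Convergence of the averages is
Fekete's lemma. Partitions are handled as finitely valued functions `index`, and joins as laws of
itineraries. -/

/-- The Shannon entropy of the distribution of a finitely valued function. -/
noncomputable def lawEntropy {X ι : Type*} [MeasurableSpace X] [Fintype ι] (μ : Measure X)
    (a : X → ι) : ℝ :=
  partitionEntropy μ fun i => a ⁻¹' {i}

/-- This is log z ≤ z - 1 at z = ty/x. The free parameter `t` is later 1 for the predicted value and
ε for the others. -/
theorem mul_log_sub_log_le {x y t : ℝ} (hx : 0 ≤ x) (hxy : x ≤ y) (ht : 0 < t) :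
    x * (Real.log y - Real.log x) ≤ -(x * Real.log t) + t * y - x := by
  rcases hx.eq_or_lt with rfl | hx
  · simp
    positivity
  · have hy : 0 < y := hx.trans_le hxy
    have h := Real.log_le_sub_one_of_pos (show 0 < t * y / x by positivity)
    rw [Real.log_div (by positivity) hx.ne', Real.log_mul ht.ne' hy.ne'] at h
    have h2 := mul_le_mul_of_nonneg_left h hx.le
    have h3 : x * (t * y / x - 1) = t * y - x := by field_simp
    rw [h3] at h2
    linarith

/-- Again log z ≤ z - 1, at z = uv/(pw): the pointwise form of strong subadditivity. -/
theorem mul_log_add_log_sub_le {p u v w : ℝ} (hp : 0 ≤ p) (hu : p ≤ u) (hv : p ≤ v) (hw : p ≤ w) :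
    p * (Real.log u + Real.log v - Real.log p - Real.log w) ≤ u * v / w - p := by
  rcases hp.eq_or_lt with rfl | hp
  · simp
    positivity
  · have hu' := hp.trans_le hu
    have hv' := hp.trans_le hv
    have hw' := hp.trans_le hw
    have h := Real.log_le_sub_one_of_pos (show 0 < u * v / (p * w) by positivity)
    rw [Real.log_div (by positivity) (by positivity), Real.log_mul hu'.ne' hv'.ne',
      Real.log_mul hp.ne' hw'.ne'] at h
    have h2 := mul_le_mul_of_nonneg_left h hp.le
    have h3 : p * (u * v / (p * w) - 1) = u * v / w - p := by field_simp
    rw [h3] at h2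
    linarith

/-! ### Shannon entropy of finitely valued functions -/

section Law

theorem sum_measureReal_inter_fiber {X κ : Type*} [MeasurableSpace X] {μ : Measure X}
    [IsFiniteMeasure μ] [Fintype κ] [MeasurableSpace κ] [MeasurableSingletonClass κ]
    {b : X → κ} (hb : Measurable b) {s : Set X} (hs : MeasurableSet s) :
    ∑ k, μ.real (b ⁻¹' {k} ∩ s) = μ.real s := by
  rw [← measureReal_biUnion_finset]
  · congr 1
    ext x
    simp
  · intro i _ j _ hij
    refine Set.disjoint_left.2 fun x hx hx' => hij ?_
    exact hx.1.symm.trans hx'.1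
  · exact fun k _ => (hb (measurableSet_singleton k)).inter hs

theorem sum_measureReal_fiber {X κ : Type*} [MeasurableSpace X] {μ : Measure X}
    [IsProbabilityMeasure μ] [Fintype κ] [MeasurableSpace κ] [MeasurableSingletonClass κ]
    {b : X → κ} (hb : Measurable b) : ∑ k, μ.real (b ⁻¹' {k}) = 1 := by
  simpa using sum_measureReal_inter_fiber (μ := μ) hb MeasurableSet.univ

theorem preimage_prodMk_singleton {X ι κ : Type*} (a : X → ι) (b : X → κ) (i : ι) (k : κ) :
    (fun x => (a x, b x)) ⁻¹' {(i, k)} = a ⁻¹' {i} ∩ b ⁻¹' {k} := by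
  ext x
  simp

theorem preimage_singleton_subset_comp {X ι κ : Type*} (b : X → κ) (φ : κ → ι) (k : κ) :
    b ⁻¹' {k} ⊆ (fun x => φ (b x)) ⁻¹' {φ k} := by
  rintro x rfl
  rfl

variable {X : Type*} [MeasurableSpace X] {μ : Measure X}
  {ι κ τ : Type*} [Fintype ι] [Fintype κ] [Fintype τ] [MeasurableSpace κ]
  [MeasurableSingletonClass κ]

/-- Puts the entropies of all functions of `b` over the same index set `κ`, where they can be
compared term by term. -/
theorem lawEntropy_comp_eq_sum [IsFiniteMeasure μ] {b : X → κ} (hb : Measurable b) (φ : κ → ι) :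
    lawEntropy μ (fun x => φ (b x)) =
      - ∑ k, μ.real (b ⁻¹' {k}) * Real.log (μ.real ((fun x => φ (b x)) ⁻¹' {φ k})) := by
  classical
  rw [lawEntropy, partitionEntropy, neg_inj, ← Finset.sum_fiberwise _ φ]
  refine Finset.sum_congr rfl fun i _ => ?_
  have h : μ.real ((fun x => φ (b x)) ⁻¹' {i}) =
      ∑ k ∈ Finset.univ.filter (fun k => φ k = i), μ.real (b ⁻¹' {k}) := by
    rw [← measureReal_biUnion_finset]
    · congr 1
      ext x
      simp
    · intro k _ l _ hkl
      refine Set.disjoint_left.2 fun x hx hx' => hkl ?_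
      exact hx.symm.trans hx'
    · exact fun k _ => hb (measurableSet_singleton k)
  nth_rewrite 1 [h]
  rw [Finset.sum_mul]
  refine Finset.sum_congr rfl fun k hk => ?_
  rw [(Finset.mem_filter.1 hk).2]

/-- The entropy does not increase when values are merged. -/
theorem lawEntropy_comp_le [IsFiniteMeasure μ] {b : X → κ} (hb : Measurable b) (φ : κ → ι) :
    lawEntropy μ (fun x => φ (b x)) ≤ lawEntropy μ b := by
  rw [lawEntropy_comp_eq_sum hb, lawEntropy, partitionEntropy, neg_le_neg_iff]
  refine Finset.sum_le_sum fun k _ => ?_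
  rcases (measureReal_nonneg (μ := μ) (s := b ⁻¹' {k})).eq_or_lt with h | h
  · rw [← h, zero_mul, zero_mul]
  · exact mul_le_mul_of_nonneg_left
      (Real.log_le_log h (measureReal_mono (preimage_singleton_subset_comp b φ k))) h.le

theorem lawEntropy_nonneg [IsProbabilityMeasure μ] (a : X → ι) : 0 ≤ lawEntropy μ a := by
  rw [lawEntropy, partitionEntropy, neg_nonneg]
  exact Finset.sum_nonpos fun i _ => mul_nonpos_of_nonneg_of_nonpos measureReal_nonneg
    (Real.log_nonpos measureReal_nonneg measureReal_le_one)

theorem lawEntropy_comp_measurePreserving [MeasurableSpace ι] [MeasurableSingletonClass ι]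
    {T : X → X} (hT : MeasurePreserving T μ μ) {a : X → ι} (ha : Measurable a) :
    lawEntropy μ (fun x => a (T x)) = lawEntropy μ a := by
  have h : ∀ i, μ.real ((fun x => a (T x)) ⁻¹' {i}) = μ.real (a ⁻¹' {i}) := fun i =>
    hT.measureReal_preimage (ha (measurableSet_singleton i)).nullMeasurableSet
  simp only [lawEntropy, partitionEntropy, h]

variable [MeasurableSpace ι] [MeasurableSingletonClass ι] [MeasurableSpace τ]
  [MeasurableSingletonClass τ] [IsProbabilityMeasure μ]

/-- Strong subadditivity of entropy. -/
theorem lawEntropy_strong_subadditive {a : X → ι} {b : X → κ} {c : X → τ} (ha : Measurable a)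
    (hb : Measurable b) (hc : Measurable c) :
    lawEntropy μ (fun x => (a x, b x, c x)) + lawEntropy μ c ≤
      lawEntropy μ (fun x => (a x, c x)) + lawEntropy μ (fun x => (b x, c x)) := by
  have hw : Measurable fun x => (a x, b x, c x) := ha.prodMk (hb.prodMk hc)
  have h0 := lawEntropy_comp_eq_sum (μ := μ) hw fun v => v
  have h1 := lawEntropy_comp_eq_sum (μ := μ) hw fun v => (v.1, v.2.2)
  have h2 := lawEntropy_comp_eq_sum (μ := μ) hw fun v => v.2
  have h3 := lawEntropy_comp_eq_sum (μ := μ) hw fun v => v.2.2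
  set p := fun v : ι × κ × τ => μ.real ((fun x => (a x, b x, c x)) ⁻¹' {v})
  set u := fun v : ι × κ × τ => μ.real ((fun x => (a x, c x)) ⁻¹' {(v.1, v.2.2)})
  set r := fun v : ι × κ × τ => μ.real ((fun x => (b x, c x)) ⁻¹' {v.2})
  set w := fun v : ι × κ × τ => μ.real (c ⁻¹' {v.2.2})
  have hmain : ∑ v, p v * (Real.log (u v) + Real.log (r v) - Real.log (p v) - Real.log (w v)) ≤
      ∑ v, (u v * r v / w v - p v) := Finset.sum_le_sum fun v _ =>
    mul_log_add_log_sub_le measureReal_nonneg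
      (measureReal_mono (preimage_singleton_subset_comp _ (fun v => (v.1, v.2.2)) v))
      (measureReal_mono (preimage_singleton_subset_comp _ (fun v => v.2) v))
      (measureReal_mono (preimage_singleton_subset_comp _ (fun v => v.2.2) v))
  have hp : ∑ v, p v = 1 := sum_measureReal_fiber hw
  -- Summing over the value of `a` turns `u` into `w`, which cancels and leaves the total mass of
  -- `r`. Where `w` vanishes, so does `r`.
  have hr : ∑ v, u v * r v / w v = 1 := by
    rw [← sum_measureReal_fiber (μ := μ) (hb.prodMk hc), Fintype.sum_prod_type_right]
    refine Finset.sum_congr rfl fun y _ => ?_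
    have hu : ∑ i, u (i, y) = μ.real (c ⁻¹' {y.2}) := by
      simp only [u, preimage_prodMk_singleton]
      exact sum_measureReal_inter_fiber ha (hc (measurableSet_singleton y.2))
    have hle : μ.real ((fun x => (b x, c x)) ⁻¹' {y}) ≤ μ.real (c ⁻¹' {y.2}) :=
      measureReal_mono (preimage_singleton_subset_comp _ (fun v : κ × τ => v.2) y)
    simp only [r, w]
    rw [← Finset.sum_div, ← Finset.sum_mul, hu]
    exact mul_div_cancel_left_of_imp fun h => le_antisymm (h ▸ hle) measureReal_nonneg
  rw [Finset.sum_sub_distrib, hp, hr] at hmain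
  simp only [mul_sub, mul_add, Finset.sum_sub_distrib, Finset.sum_add_distrib] at hmain
  linarith

theorem lawEntropy_prodMk_le {a : X → ι} {b : X → κ} (ha : Measurable a) (hb : Measurable b) :
    lawEntropy μ (fun x => (a x, b x)) ≤ lawEntropy μ a + lawEntropy μ b := by
  have hc : Measurable fun _ : X => () := measurable_const
  have h := lawEntropy_strong_subadditive (μ := μ) ha hb hc
  have h1 : lawEntropy μ (fun x => (a x, b x)) ≤ lawEntropy μ (fun x => (a x, b x, ())) :=
    lawEntropy_comp_le (ha.prodMk (hb.prodMk hc)) fun v => (v.1, v.2.1)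
  have h2 : lawEntropy μ (fun x => (a x, ())) ≤ lawEntropy μ a :=
    lawEntropy_comp_le ha fun v => (v, ())
  have h3 : lawEntropy μ (fun x => (b x, ())) ≤ lawEntropy μ b :=
    lawEntropy_comp_le hb fun v => (v, ())
  have h4 := lawEntropy_nonneg (μ := μ) fun _ : X => ()
  linarith

open Classical in
/-- If `a` is predicted from `q` by `ℓ` with error at most `ε` for each value, the conditional
entropy of `a` given `q` is small. -/
theorem lawEntropy_prodMk_le_of_approx {a : X → ι} {q : X → κ} (ha : Measurable a)
    (hq : Measurable q) (ℓ : κ → ι) {ε : ℝ} (hε : 0 < ε) (hε1 : ε ≤ 1)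
    (herr : ∀ i, μ.real {x | a x = i ∧ i ≠ ℓ (q x)} ≤ ε) :
    lawEntropy μ (fun x => (a x, q x)) ≤
      lawEntropy μ q + Fintype.card ι * (ε * (1 - Real.log ε) + ε) := by
  have hw : Measurable fun x => (a x, q x) := ha.prodMk hq
  have h0 := lawEntropy_comp_eq_sum (μ := μ) hw fun v => v
  have h1 := lawEntropy_comp_eq_sum (μ := μ) hw fun v => v.2
  set p := fun v : ι × κ => μ.real ((fun x => (a x, q x)) ⁻¹' {v}) with hpdef
  set w := fun k : κ => μ.real (q ⁻¹' {k}) with hwdef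
  -- `g` is the mass of the wrongly predicted pairs.
  set g := fun v : ι × κ => if v.1 = ℓ v.2 then 0 else p v with hgdef
  have hlog : Real.log ε ≤ 0 := Real.log_nonpos hε.le hε1
  have hw1 : ∑ k, w k = 1 := sum_measureReal_fiber hq
  have hpw : ∀ k, ∑ i, p (i, k) = w k := fun k => by
    simp only [hpdef, preimage_prodMk_singleton]
    exact sum_measureReal_inter_fiber ha (hq (measurableSet_singleton k))
  have hg : ∀ i, ∑ k, g (i, k) ≤ ε := fun i => by
    refine le_trans (le_of_eq ?_) (herr i)
    have hs : MeasurableSet {x | a x = i ∧ i ≠ ℓ (q x)} :=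
      (ha (measurableSet_singleton i)).inter
        (hq (Set.toFinite {k | i ≠ ℓ k}).measurableSet)
    rw [← sum_measureReal_inter_fiber hq hs]
    refine Finset.sum_congr rfl fun k _ => ?_
    simp only [hgdef, hpdef]
    split_ifs with h
    · rw [eq_comm]
      convert measureReal_empty
      ext x
      simp only [Set.mem_inter_iff, Set.mem_preimage, Set.mem_singleton_iff, Set.mem_ofPred_eq,
        Set.mem_empty_iff_false, iff_false]
      rintro ⟨rfl, -, h'⟩
      exact h' h
    · congr 1
      ext x
      simp only [Set.mem_inter_iff, Set.mem_preimage, Set.mem_singleton_iff, Set.mem_ofPred_eq,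
        Prod.mk.injEq]
      constructor
      · rintro ⟨rfl, rfl⟩
        exact ⟨rfl, rfl, h⟩
      · rintro ⟨rfl, rfl, -⟩
        exact ⟨rfl, rfl⟩
  have hk : ∀ k, ∑ i, p (i, k) * (Real.log (w k) - Real.log (p (i, k))) ≤
      ∑ i, (g (i, k) * (1 - Real.log ε) + ε * w k) := fun k => by
    have hle : ∀ i, p (i, k) ≤ w k := fun i =>
      measureReal_mono (preimage_singleton_subset_comp _ (fun v : ι × κ => v.2) (i, k))
    have hsum : w k - p (ℓ k, k) = ∑ i, g (i, k) := by
      rw [← hpw k, ← Finset.add_sum_erase _ _ (Finset.mem_univ (ℓ k)),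
        ← Finset.add_sum_erase _ (fun i => g (i, k)) (Finset.mem_univ (ℓ k))]
      simp only [hgdef, if_true, zero_add, add_sub_cancel_left]
      refine Finset.sum_congr rfl fun i hi => ?_
      rw [if_neg (Finset.ne_of_mem_erase hi)]
    -- The predicted value, with t = 1, contributes at most the whole error mass in the fibre of
    -- `k`; each other value is bounded with t = ε.
    calc _ ≤ ∑ i, ((if i = ℓ k then w k - p (ℓ k, k) else 0) +
          (-(g (i, k) * Real.log ε) + ε * w k)) := by
          refine Finset.sum_le_sum fun i _ => ?_
          have hw0 : 0 ≤ ε * w k := mul_nonneg hε.le measureReal_nonneg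
          have hp0 : 0 ≤ p (i, k) := measureReal_nonneg
          simp only [hgdef]
          split_ifs with h
          · have := mul_log_sub_log_le hp0 (hle i) one_pos
            simp only [Real.log_one] at this
            rw [← h]
            linarith
          · have := mul_log_sub_log_le hp0 (hle i) hε
            linarith
      _ = _ := by
          rw [Finset.sum_add_distrib, Finset.sum_ite_eq' _ _ fun _ => w k - p (ℓ k, k),
            if_pos (Finset.mem_univ _), hsum, ← Finset.sum_add_distrib]
          exact Finset.sum_congr rfl fun i _ => by ring
  have htot : ∑ v : ι × κ, p v * (Real.log (w v.2) - Real.log (p v)) ≤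
      Fintype.card ι * (ε * (1 - Real.log ε) + ε) := by
    rw [Fintype.sum_prod_type_right]
    refine (Finset.sum_le_sum fun k _ => hk k).trans ?_
    rw [Finset.sum_comm, ← nsmul_eq_mul, ← Finset.card_univ]
    refine Finset.sum_le_card_nsmul _ _ _ fun i _ => ?_
    rw [Finset.sum_add_distrib, ← Finset.sum_mul, ← Finset.mul_sum, hw1, mul_one]
    gcongr
    · linarith
    · exact hg i
  simp only [mul_sub, Finset.sum_sub_distrib] at htot
  linarith

end Law

/-! ### Partitions as index functions, and partitions of small diameter -/

namespace FinMeasPartition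

variable {X : Type*} [MeasurableSpace X] (P : FinMeasPartition X)

/-- The index of the cell that contains a given point. -/
noncomputable def index (x : X) : Fin P.card :=
  (Set.mem_iUnion.1 (P.iUnion_cell ▸ Set.mem_univ x)).choose

theorem mem_cell_index (x : X) : x ∈ P.cell (P.index x) :=
  (Set.mem_iUnion.1 (P.iUnion_cell ▸ Set.mem_univ x)).choose_spec

theorem mem_cell_iff {x : X} {i : Fin P.card} : x ∈ P.cell i ↔ P.index x = i := by
  refine ⟨fun h => ?_, fun h => h ▸ P.mem_cell_index x⟩
  by_contra hne
  exact Set.disjoint_left.1 (P.disjoint_cell _ _ hne) (P.mem_cell_index x) h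

theorem preimage_index_singleton (i : Fin P.card) : P.index ⁻¹' {i} = P.cell i := by
  ext x
  exact P.mem_cell_iff.symm

theorem measurable_index : Measurable P.index :=
  measurable_to_countable' fun i => P.preimage_index_singleton i ▸ P.measurableSet_cell i

end FinMeasPartition

/-- A compact metric space has finite measurable partitions with cells of arbitrarily small
diameter. -/
theorem exists_finMeasPartition_dist_lt (X : Type*) [MetricSpace X] [CompactSpace X]
    [MeasurableSpace X] [BorelSpace X] {δ : ℝ} (hδ : 0 < δ) :
    ∃ Q : FinMeasPartition X, ∀ x y, Q.index x = Q.index y → dist x y < δ := by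
  obtain ⟨t, -, htf, ht⟩ :=
    (isCompact_univ (X := X)).finite_cover_balls (half_pos hδ)
  lift t to Finset X using htf
  let c : Fin t.card → X := fun i => t.equivFin.symm i
  let Q : FinMeasPartition X :=
    { card := t.card
      cell := fun i => Metric.ball (c i) (δ / 2) \ ⋃ j, ⋃ (_ : j < i), Metric.ball (c j) (δ / 2)
      measurableSet_cell := fun i => measurableSet_ball.diff
        (MeasurableSet.iUnion fun j => MeasurableSet.iUnion fun _ => measurableSet_ball)
      disjoint_cell := by
        intro i j hij
        refine Set.disjoint_left.2 fun x hx hx' => ?_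
        rcases hij.lt_or_gt with h | h
        · exact hx'.2 (Set.mem_iUnion₂.2 ⟨i, h, hx.1⟩)
        · exact hx.2 (Set.mem_iUnion₂.2 ⟨j, h, hx'.1⟩)
      iUnion_cell := by
        refine Set.eq_univ_of_forall fun x => ?_
        have hx : ∃ i, x ∈ Metric.ball (c i) (δ / 2) := by
          obtain ⟨y, hy, hxy⟩ := Set.mem_iUnion₂.1 (ht (Set.mem_univ x))
          exact ⟨t.equivFin ⟨y, hy⟩, by simpa [c] using hxy⟩
        obtain ⟨i, hi, hmin⟩ := WellFounded.has_min (wellFounded_lt (α := Fin t.card))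
          {i | x ∈ Metric.ball (c i) (δ / 2)} hx
        refine Set.mem_iUnion.2 ⟨i, hi, fun h => ?_⟩
        obtain ⟨j, hj, hxj⟩ := Set.mem_iUnion₂.1 h
        exact hmin j hxj hj }
  refine ⟨Q, fun x y hxy => ?_⟩
  have hx : dist x (c (Q.index x)) < δ / 2 := (Q.mem_cell_index x).1
  have hy : dist y (c (Q.index x)) < δ / 2 := hxy ▸ (Q.mem_cell_index y).1
  linarith [dist_triangle_right x y (c (Q.index x))]

theorem orbitMap_const {X : Type*} (T : X → X) (n : ℕ) : orbitMap (X := fun _ => X) (fun _ => T) n = T^[n] := by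
  induction n with
  | zero => rfl
  | succ n ih => rw [orbitMap, ih, Function.iterate_succ']

/-! ### Itineraries, convergence of the averages, comparison of joins -/

section Itinerary

variable {X : Type*} [MeasurableSpace X]

/-- The cells visited by the first `n` points of an orbit, with respect to a sequence of
partitions. -/
noncomputable def itinerary (T : X → X) (P : ℕ → FinMeasPartition X) (n : ℕ) (x : X) :
    ∀ i : Fin n, Fin (P i).card :=
  fun i => (P i).index (T^[i] x)

variable {T : X → X}

theorem measurable_itinerary (hT : Measurable T) (P : ℕ → FinMeasPartition X) (n : ℕ) :
    Measurable (itinerary T P n) :=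
  measurable_pi_lambda _ fun i => (P i).measurable_index.comp (hT.iterate i)

theorem iInter_preimage_cell_eq (P : ℕ → FinMeasPartition X) (n : ℕ)
    (s : ∀ i : Fin n, Fin (P i).card) :
    ⋂ i : Fin n, T^[i] ⁻¹' (P i).cell (s i) = itinerary T P n ⁻¹' {s} := by
  ext x
  simp only [Set.mem_iInter, Set.mem_preimage, Set.mem_singleton_iff, funext_iff, itinerary,
    FinMeasPartition.mem_cell_iff]

theorem ksAverage_eq (T : X → X) (μ : Measure X) (P : FinMeasPartition X) (n : ℕ) :
    ksAverage T μ P n = lawEntropy μ (itinerary T (fun _ => P) n) / n := by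
  rw [ksAverage, lawEntropy, one_div_mul_eq_div]
  congr 2
  funext s
  exact iInter_preimage_cell_eq (fun _ => P) n s

theorem metricEntropyOn_const (T : X → X) (μ : Measure X) (P : ℕ → FinMeasPartition X) :
    metricEntropyOn (X := fun _ => X) (fun _ => T) (fun _ => μ) P =
      limsup (fun n : ℕ => ((lawEntropy μ (itinerary T P n) / n : ℝ) : EReal)) atTop := by
  rw [metricEntropyOn]
  congr 1
  funext n
  rw [lawEntropy, one_div_mul_eq_div]
  congr 3
  funext s
  rw [← iInter_preimage_cell_eq, joinCells]
  simp only [orbitMap_const]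

variable {μ : Measure X} [IsProbabilityMeasure μ]

/-- An orbit word of length m + n is the word of length m followed by the word of length n seen from
`T^[m] x`, which has the same law by invariance. -/
theorem subadditive_lawEntropy_orbit {κ : Type*} [Fintype κ] [MeasurableSpace κ]
    [MeasurableSingletonClass κ] (hT : MeasurePreserving T μ μ) {a : X → κ} (ha : Measurable a) :
    Subadditive fun n => lawEntropy μ fun x (i : Fin n) => a (T^[i] x) := by
  intro m n
  have hw : ∀ n, Measurable fun x (i : Fin n) => a (T^[i] x) := fun n =>
    measurable_pi_lambda _ fun i => ha.comp (hT.measurable.iterate i)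
  have hTm := hT.iterate m
  have hn : Measurable fun x (i : Fin n) => a (T^[i] (T^[m] x)) := (hw n).comp hTm.measurable
  have hφ : (fun x (i : Fin (m + n)) => a (T^[i] x)) = fun x =>
      Fin.append (fun i : Fin m => a (T^[i] x)) (fun i : Fin n => a (T^[i] (T^[m] x))) := by
    funext x i
    refine Fin.addCases (fun i => ?_) (fun i => ?_) i
    · simp
    · rw [Fin.append_right, Fin.val_natAdd, add_comm, Function.iterate_add_apply]
  have h1 := lawEntropy_comp_le (μ := μ) ((hw m).prodMk hn) fun v => Fin.append v.1 v.2
  have h2 := lawEntropy_prodMk_le (μ := μ) (hw m) hn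
  have h3 := lawEntropy_comp_measurePreserving hTm (hw n)
  beta_reduce
  rw [hφ]
  linarith

theorem subadditive_lawEntropy_itinerary (hT : MeasurePreserving T μ μ) (P : FinMeasPartition X) :
    Subadditive fun n => lawEntropy μ (itinerary T (fun _ => P) n) :=
  subadditive_lawEntropy_orbit hT P.measurable_index

theorem exists_tendsto_ksAverage (hT : MeasurePreserving T μ μ) (P : FinMeasPartition X) :
    ∃ L : ℝ, Tendsto (ksAverage T μ P) atTop (𝓝 L) ∧ ksEntropyOn T μ P = L := by
  have h := (subadditive_lawEntropy_itinerary hT P).tendsto_lim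
    ⟨0, Set.forall_mem_range.2 fun n => div_nonneg (lawEntropy_nonneg _) n.cast_nonneg⟩
  simp only [← ksAverage_eq] at h
  exact ⟨_, h, ((continuous_coe_real_ereal.tendsto _).comp h).limsup_eq⟩

/-- If each `P n` has conditional entropy at most `η` given `Q n`, then the itineraries along `P`
have conditional entropy at most `n * η` given those along `Q`. -/
theorem lawEntropy_itinerary_prodMk_le (hT : MeasurePreserving T μ μ)
    {P Q : ℕ → FinMeasPartition X} {η : ℝ}
    (h : ∀ n, lawEntropy μ (fun x => ((P n).index x, (Q n).index x)) ≤
      lawEntropy μ (Q n).index + η) (n : ℕ) :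
    lawEntropy μ (fun x => (itinerary T P n x, itinerary T Q n x)) ≤
      lawEntropy μ (itinerary T Q n) + n * η := by
  induction n with
  | zero =>
    have := lawEntropy_comp_le (μ := μ) (measurable_itinerary hT.measurable Q 0)
      fun v => ((fun i => i.elim0 : ∀ i : Fin 0, Fin (P i).card), v)
    rw [Nat.cast_zero, zero_mul, add_zero]
    convert this
  | succ n ih =>
    have hTn := hT.iterate n
    have hD := measurable_itinerary hT.measurable P n
    have hE := measurable_itinerary hT.measurable Q n
    have hp : Measurable fun x => (P n).index (T^[n] x) :=
      (P n).measurable_index.comp hTn.measurable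
    have hq : Measurable fun x => (Q n).index (T^[n] x) :=
      (Q n).measurable_index.comp hTn.measurable
    have hsnoc : ∀ (R : ℕ → FinMeasPartition X) (x : X), itinerary T R (n + 1) x =
        Fin.snoc (α := fun i : Fin (n + 1) => Fin (R i).card) (itinerary T R n x)
          ((R n).index (T^[n] x)) := by
      intro R x
      funext i
      refine Fin.lastCases ?_ (fun i => ?_) i
      · rw [Fin.snoc_last]
        rfl
      · rw [Fin.snoc_castSucc]
        rfl
    have h1 : lawEntropy μ (fun x => (itinerary T P (n + 1) x, itinerary T Q (n + 1) x)) ≤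
        lawEntropy μ fun x => ((P n).index (T^[n] x), (itinerary T P n x, itinerary T Q n x),
          (Q n).index (T^[n] x)) := by
      simp only [hsnoc]
      exact lawEntropy_comp_le (hp.prodMk ((hD.prodMk hE).prodMk hq)) fun v =>
        (Fin.snoc (α := fun i : Fin (n + 1) => Fin (P i).card) v.2.1.1 v.1,
          Fin.snoc (α := fun i : Fin (n + 1) => Fin (Q i).card) v.2.1.2 v.2.2)
    -- With `h3`: the new symbol of `P n`, given the past and the new symbol of `Q n`, has
    -- conditional entropy at most η.
    have h2 := lawEntropy_strong_subadditive (μ := μ) hp (hD.prodMk hE) hq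
    have h3 : lawEntropy μ (fun x => ((P n).index (T^[n] x), (Q n).index (T^[n] x))) ≤
        lawEntropy μ (fun x => (Q n).index (T^[n] x)) + η := by
      rw [lawEntropy_comp_measurePreserving hTn (Q n).measurable_index]
      refine le_trans (le_of_eq ?_) (h n)
      exact lawEntropy_comp_measurePreserving hTn
        ((P n).measurable_index.prodMk (Q n).measurable_index)
    have h4 : lawEntropy μ (fun x => ((itinerary T P n x, itinerary T Q n x),
          (Q n).index (T^[n] x))) ≤
        lawEntropy μ fun x => (itinerary T P n x, (Q n).index (T^[n] x), itinerary T Q n x) :=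
      lawEntropy_comp_le (hD.prodMk (hq.prodMk hE)) fun v => ((v.1, v.2.2), v.2.1)
    -- Also conditioning on the new symbol of `Q n` does not increase the conditional entropy of the
    -- `P`-past given the `Q`-past, so `ih` still applies.
    have h5 := lawEntropy_strong_subadditive (μ := μ) hD hq hE
    have h6 : lawEntropy μ (fun x => ((Q n).index (T^[n] x), itinerary T Q n x)) ≤
        lawEntropy μ (itinerary T Q (n + 1)) :=
      lawEntropy_comp_le (measurable_itinerary hT.measurable Q (n + 1)) fun v =>
        ((v (Fin.last n), fun i : Fin n => v i.castSucc) :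
          Fin (Q n).card × ∀ i : Fin n, Fin (Q i).card)
    push_cast
    linarith

/-- The comparison of two sequences of partitions, at the level of the asymptotic entropies. -/
theorem metricEntropyOn_le_ksEntropyOn_add (hT : MeasurePreserving T μ μ)
    {P : ℕ → FinMeasPartition X} {Q : FinMeasPartition X} {η : ℝ} (hη : 0 ≤ η)
    (h : ∀ n, lawEntropy μ (fun x => ((P n).index x, Q.index x)) ≤ lawEntropy μ Q.index + η) :
    metricEntropyOn (X := fun _ => X) (fun _ => T) (fun _ => μ) P ≤ ksEntropyOn T μ Q + η := by
  obtain ⟨L, hL, hLQ⟩ := exists_tendsto_ksAverage hT Q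
  have hlim := ((continuous_coe_real_ereal.tendsto _).comp (hL.add_const η)).limsup_eq
  rw [hLQ, ← EReal.coe_add, ← hlim, metricEntropyOn_const]
  refine limsup_le_limsup (Eventually.of_forall fun n => EReal.coe_le_coe_iff.2 ?_)
  have h1 := lawEntropy_itinerary_prodMk_le hT (Q := fun _ => Q) h n
  have h2 : lawEntropy μ (itinerary T P n) ≤
      lawEntropy μ fun x => (itinerary T P n x, itinerary T (fun _ => Q) n x) :=
    lawEntropy_comp_le ((measurable_itinerary hT.measurable P n).prodMk
      (measurable_itinerary hT.measurable (fun _ => Q) n)) fun v => v.1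
  simp only [ksAverage_eq]
  rcases n.eq_zero_or_pos with rfl | hn
  -- At n = 0 both quotients are 0 by the convention for division by zero.
  · simpa using hη
  · have hn' : (0 : ℝ) < n := Nat.cast_pos.2 hn
    rw [div_add' _ _ _ hn'.ne', mul_comm η]
    exact div_le_div_of_nonneg_right (h2.trans h1) hn'.le

end Itinerary

/-- The expression is continuous in ε, through `Real.negMulLog`, and vanishes at 0. -/
theorem exists_mul_one_sub_log_add_le (m : ℕ) {η : ℝ} (hη : 0 < η) :
    ∃ ε : ℝ, 0 < ε ∧ ε ≤ 1 ∧ m * (ε * (1 - Real.log ε) + ε) ≤ η := by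
  have hc : Continuous fun ε : ℝ => m * (ε + Real.negMulLog ε + ε) := by fun_prop
  have ht := hc.tendsto 0
  simp only [Real.negMulLog_zero, add_zero, mul_zero] at ht
  have h1 := (ht.eventually (gt_mem_nhds hη)).filter_mono (nhdsWithin_le_nhds (s := Set.Ioi 0))
  obtain ⟨ε, hε, hε0⟩ := (h1.and (Ioc_mem_nhdsGT one_pos)).exists
  refine ⟨ε, hε0.1, hε0.2, le_of_eq_of_le ?_ hε.le⟩
  rw [Real.negMulLog]
  ring

/-! ### Admissible sequences -/

section Admissible

variable {X : Type*} [MetricSpace X] [CompactSpace X] [MeasurableSpace X] [BorelSpace X]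
  {μ : Measure X} [IsProbabilityMeasure μ]

/-- A constant sequence of partitions is admissible. -/
theorem isAdmissible_const (P : FinMeasPartition X) :
    IsAdmissible (X := fun _ => X) (fun _ => μ) fun _ => P := by
  refine ⟨⟨P.card, fun _ => le_rfl⟩, fun ε hε => ?_⟩
  choose K hKP hK hμK using fun i => (P.measurableSet_cell i).exists_isCompact_sdiff_lt
    (measure_ne_top μ _) (ENNReal.ofReal_pos.2 hε).ne'
  have hδ : ∀ v : Fin P.card × Fin P.card, ∃ δ : ℝ, 0 < δ ∧
      (v.1 ≠ v.2 → ∀ x ∈ K v.1, ∀ y ∈ K v.2, δ ≤ dist x y) := by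
    rintro ⟨i, j⟩
    by_cases hij : i = j
    -- The diagonal carries no condition, so 1 is a dummy value.
    · exact ⟨1, one_pos, fun h => absurd hij h⟩
    · obtain ⟨r, hr, h⟩ := Metric.exists_pos_forall_lt_edist (hK i) (hK j).isClosed
        ((P.disjoint_cell i j hij).mono (hKP i) (hKP j))
      refine ⟨r, hr, fun _ x hx y hy => ?_⟩
      have := h x hx y hy
      rw [edist_nndist, ENNReal.coe_lt_coe] at this
      exact_mod_cast this.le
  choose d hd hdK using hδ
  obtain ⟨δ, hδ, hδ0⟩ := ((eventually_all.2 fun v => Ioo_mem_nhdsGT (hd v)).and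
    (self_mem_nhdsWithin (a := (0 : ℝ)) (s := Set.Ioi 0))).exists
  refine ⟨δ, hδ0, fun _ => K, fun _ => ⟨fun i => ⟨hK i, hKP i, (hμK i).le⟩, ?_⟩⟩
  intro i j hij x hx y hy
  exact (hδ (i, j)).2.le.trans (hdK (i, j) hij.ne x hx y hy)

/-- An admissible sequence of partitions is uniformly approximated by a single partition, in the
sense of conditional entropy. -/
theorem IsAdmissible.exists_lawEntropy_prodMk_le {P : ℕ → FinMeasPartition X}
    (hP : IsAdmissible (X := fun _ => X) (fun _ => μ) P) {η : ℝ} (hη : 0 < η) :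
    ∃ Q : FinMeasPartition X, ∀ n,
      lawEntropy μ (fun x => ((P n).index x, Q.index x)) ≤ lawEntropy μ Q.index + η := by
  classical
  obtain ⟨⟨m, hm⟩, hP⟩ := hP
  obtain ⟨ε, hε, hε1, hεη⟩ := exists_mul_one_sub_log_add_le m hη
  obtain ⟨δ, hδ, K, hK⟩ := hP ε hε
  obtain ⟨Q, hQ⟩ := exists_finMeasPartition_dist_lt X hδ
  have x₀ : X := (nonempty_of_isProbabilityMeasure μ).some
  refine ⟨Q, fun n => ?_⟩
  obtain ⟨hKn, hdist⟩ := hK n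
  have hsep : ∀ i j, ∀ x ∈ K n i, ∀ y ∈ K n j, dist x y < δ → i = j := by
    intro i j x hx y hy hxy
    rcases lt_trichotomy i j with h | h | h
    · exact absurd hxy (hdist i j h x hx y hy).not_gt
    · exact h
    · exact absurd hxy (dist_comm x y ▸ hdist j i h y hy x hx).not_gt
  -- Points of one cell of `Q` are less than δ apart, so they lie in at most one `K n j`. If the
  -- cell misses them all, any label will do, and `x₀` supplies one. The labelling depends on `n`;
  -- `Q` does not.
  have hℓ : ∀ k, ∃ j, ∀ x, Q.index x = k → ∀ i, x ∈ K n i → i = j := by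
    intro k
    by_cases h : ∃ y j, Q.index y = k ∧ y ∈ K n j
    · obtain ⟨y, j, hy, hyj⟩ := h
      exact ⟨j, fun x hx i hi => hsep i j x hi y hyj (hQ x y (hx.trans hy.symm))⟩
    · push Not at h
      exact ⟨(P n).index x₀, fun x hx i hi => absurd hi (h x i hx)⟩
  choose ℓ hℓ using hℓ
  -- A wrongly predicted point of cell `i` lies outside `K n i`.
  have herr : ∀ i, μ.real {x | (P n).index x = i ∧ i ≠ ℓ (Q.index x)} ≤ ε := fun i => by
    refine ENNReal.toReal_le_of_le_ofReal hε.le (le_trans (measure_mono ?_) (hKn i).2.2)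
    rintro x ⟨hxi, hne⟩
    exact ⟨(P n).mem_cell_iff.2 hxi, fun hx => hne (hℓ _ x rfl i hx)⟩
  refine (lawEntropy_prodMk_le_of_approx (P n).measurable_index Q.measurable_index ℓ hε hε1
    herr).trans ?_
  rw [Fintype.card_fin]
  have hlog : Real.log ε ≤ 0 := Real.log_nonpos hε.le hε1
  have hpos : 0 ≤ ε * (1 - Real.log ε) + ε :=
    add_nonneg (mul_nonneg hε.le (by linarith)) hε.le
  have hcard : ((P n).card : ℝ) ≤ m := Nat.cast_le.2 (hm n)
  linarith [mul_le_mul_of_nonneg_right hcard hpos]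

end Admissible

end NonautEntropy

/-- For a continuous measure-preserving map `T` of a compact metric probability space, the limits in
the definition of the Kolmogorov–Sinai entropy exist, and the metric entropy of the constant
nonautonomous system `(X, T, μ)` is the Kolmogorov–Sinai entropy of `T`. -/
theorem corollary3p7 {X : Type*} [MetricSpace X] [CompactSpace X]
    [MeasurableSpace X] [BorelSpace X] (T : X → X) (hT : Continuous T)
    (μ : MeasureTheory.Measure X) [MeasureTheory.IsProbabilityMeasure μ]
    (hμ : MeasureTheory.MeasurePreserving T μ μ) :
    (∀ P : NonautEntropy.FinMeasPartition X,
      Filter.Tendsto (fun n : ℕ => (NonautEntropy.ksAverage T μ P n : EReal)) Filter.atTop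
        (nhds (NonautEntropy.ksEntropyOn T μ P))) ∧
    NonautEntropy.metricEntropy (X := fun _ : ℕ => X) (fun _ => T) (fun _ => μ) =
      NonautEntropy.ksEntropy T μ := by
  refine ⟨fun P => ?_, le_antisymm (iSup₂_le fun P hP => ?_) (iSup_le fun P => ?_)⟩
  · obtain ⟨L, hL, hLP⟩ := NonautEntropy.exists_tendsto_ksAverage hμ P
    rw [hLP]
    exact (continuous_coe_real_ereal.tendsto _).comp hL
  -- Comparison with real `z` above the entropy disposes of the value ⊤; once ⊥ is excluded, the
  -- entropy is a real `s` and η = z - s is available.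
  · refine EReal.le_of_forall_lt_iff_le.1 fun z hz => ?_
    have hbot : NonautEntropy.ksEntropy T μ ≠ ⊥ := by
      obtain ⟨Q, -⟩ := NonautEntropy.IsAdmissible.exists_lawEntropy_prodMk_le hP one_pos
      obtain ⟨L, -, hLQ⟩ := NonautEntropy.exists_tendsto_ksAverage hμ Q
      have hle : (L : EReal) ≤ NonautEntropy.ksEntropy T μ :=
        hLQ ▸ le_iSup (NonautEntropy.ksEntropyOn T μ) Q
      exact ((EReal.bot_lt_coe L).trans_le hle).ne'
    obtain ⟨s, hs⟩ : ∃ s : ℝ, (s : EReal) = NonautEntropy.ksEntropy T μ :=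
      ⟨_, EReal.coe_toReal (hz.trans (EReal.coe_lt_top z)).ne hbot⟩
    rw [← hs, EReal.coe_lt_coe_iff] at hz
    obtain ⟨Q, hQ⟩ :=
      NonautEntropy.IsAdmissible.exists_lawEntropy_prodMk_le hP (sub_pos.2 hz)
    calc _ ≤ NonautEntropy.ksEntropyOn T μ Q + ((z - s : ℝ) : EReal) :=
          NonautEntropy.metricEntropyOn_le_ksEntropyOn_add hμ (sub_pos.2 hz).le hQ
      _ ≤ (s : EReal) + ((z - s : ℝ) : EReal) := by
          gcongr
          exact hs ▸ le_iSup (NonautEntropy.ksEntropyOn T μ) Q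
      _ = z := by rw [← EReal.coe_add, add_sub_cancel]
  · refine le_trans (le_of_eq ?_) (le_iSup₂ (fun _ => P) (NonautEntropy.isAdmissible_const P))
    rw [NonautEntropy.metricEntropyOn_const, NonautEntropy.ksEntropyOn]
    simp only [NonautEntropy.ksAverage_eq]
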